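/- Conventions. All first-order models have at least two elements. Formulas are in negation normal form, and a team $X$ over a model $\mathfrak M$ with domain $M$ is a set of assignments $s:V\to M$ for a finite set $V$ of variables. Satisfaction $\mathfrak M\models_X\phi$ is defined as follows: literals hold in $X$ iff they hold (in Tarski's sense) under every $s\in X$; $\mathfrak M\models_X\psi_1\wedge\psi_2$ iff $\mathfrak M\models_X\psi_1$ and $\mathfrak M\models_X\psi_2$; $\mathfrak M\models_X\psi_1\vee\psi_2$ iff $X=Y\cup Z$ for some $Y,Z$ with $\mathfrak M\models_Y\psi_1$ and $\mathfrak M\models_Z\psi_2$; $\mathfrak M\models_X\exists v\,\psi$ iff there is a function $H$ assigning to each $s\in X$ a nonempty set $H(s)\subseteq M$ such that $\mathfrak M\models_{X'}\psi$ for $X'=\{s[m/v]: s\in X,\ m\in H(s)\}$; and $\mathfrak M\models_X\forall v\,\psi$ iff $\mathfrak M\models_{X'}\psi$ for $X'=\{s[m/v]: s\in X,\ m\in M\}$. A sentence is true in $\mathfrak M$ iff it is satisfied by the team $\{\epsilon\}$ containing only the empty assignment. For an $r$-tuple $\vec t$ of terms put $X(\vec t)=\{s(\vec t): s\in X\}\subseteq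 M^r$. A dependency of arity $r$ is a first-order sentence $\mathbf D(R)$ over the signature $\{R\}$, with $R$ an $r$-ary relation symbol; the atom $\mathbf D\,\vec t$ is satisfied by $X$ iff $(M,X(\vec t))\models\mathbf D(R)$. For a set $\mathcal D$ of dependencies, $\mathrm{FO}(\mathcal D)$ is first-order logic with this semantics extended by all atoms $\mathbf D\,\vec t$ with $\mathbf D\in\mathcal D$. For $k\in\mathbb N$, let $\subseteq_k$ be the $2k$-ary dependency $\forall\vec u\,\vec v\,(R\vec u\vec v\rightarrow\exists\vec w\,R\vec w\vec u)$ (so that the inclusion atom $\vec x\subseteq\vec y$, with $|\vec x|=|\vec y|=k$, says $X(\vec x)\subseteq X(\vec y)$), and let $|_k$ be the $2k$-ary dependency $\forall\vec u\,\vec v\,\vec u'\,\vec v'\,((R\vec u\vec v\wedge R\vec u'\vec v')\rightarrow(\vec u\neq\vec v'\wedge\vec v\neq\vec u'))$ (so that the exclusion atom $\vec x\mid\vec y$ says $X(\vec x)\cap X(\vec y)=\emptyset$), where $\vec u,\vec v,\vec w,\vec u',\vec v'$ are $k$-tuples of variables. Corollary (inclusion in exclusion logic). For every first-order signature and every $k\in\mathbb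 N$, every sentence $\phi$ of $\mathrm{FO}(\subseteq_k)$ is equivalent to some sentence $\psi$ of $\mathrm{FO}(|_k)$ over the same signature: $\phi$ is true in $\mathfrak M$ if and only if $\psi$ is true in $\mathfrak M$, for every model $\mathfrak M$ of that signature with at least two elements. -/

import Mathlib

universe u v w

namespace TeamLogic

open FirstOrder

/-! ### First order dependencies -/

/-- The signature consisting of a single relation symbol, of arity `r`. -/
def relSig (r : ℕ) : FirstOrder.Language.{0, 0} where
  Functions _ := Empty
  Relations n := PLift (n = r)

/-- The relation symbol of `relSig r`. -/
def relSym (r : ℕ) : (relSig r).Relations r := ⟨rfl⟩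

/-- The model `(M, S)` over the signature `relSig r` in which the relation symbol is interpreted
by the relation `S`. -/
abbrev relStructure {M : Type w} (r : ℕ) (S : Set (Fin r → M)) : (relSig r).Structure M where
  funMap f _ := Empty.elim f
  RelMap h a := (fun i => a (Fin.cast h.down.symm i)) ∈ S

/-- A first order dependency: a first order sentence `D(R)` over the signature `{R}`, where `R` is
a relation symbol of the given arity. -/
structure Dependency where
  arity : ℕ
  sentence : (relSig arity).Sentence

/-- `(M, S) ⊨ D(R)` in the usual Tarskian semantics, where `R` is interpreted by `S`. -/
def Dependency.Holds {M : Type w} (D : Dependency) (S : Set (Fin D.arity → M)) : Prop :=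
  letI := relStructure D.arity S
  M ⊨ D.sentence

/-- The atomic formula `R x y`, where `R` has arity `k + k` and `x`, `y` are `k`-tuples of
variables. -/
def relPair (k : ℕ) {α : Type} (x y : Fin k → α) : (relSig (k + k)).Formula α :=
  (relSym (k + k)).formula (fun i => FirstOrder.Language.Term.var (Fin.append x y i))

/-- The formula `x ≠ y` for `k`-tuples of variables `x`, `y`: it is not the case that they
agree in all components. -/
noncomputable def tupleNe (k : ℕ) {r : ℕ} {α : Type} (x y : Fin k → α) : (relSig r).Formula α :=
  ∼(FirstOrder.Language.Formula.iInf fun i =>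
    FirstOrder.Language.Term.equal (FirstOrder.Language.Term.var (x i)) (FirstOrder.Language.Term.var (y i)))

/-- The `k`-ary inclusion dependency `∀ u v (R u v → ∃ w R w u)`, with `u`, `v`, `w` being
`k`-tuples of variables. -/
noncomputable abbrev inclusion (k : ℕ) : Dependency where
  arity := k + k
  sentence := FirstOrder.Language.Formula.iAlls (Fin k ⊕ Fin k)
    (FirstOrder.Language.BoundedFormula.imp
      (relPair k (fun i => Sum.inr (Sum.inl i)) (fun i => Sum.inr (Sum.inr i)))
      (FirstOrder.Language.Formula.iExs (Fin k)
        (relPair k (fun i => Sum.inr i) (fun i => Sum.inl (Sum.inr (Sum.inl i))))))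

/-- The `k`-ary exclusion dependency
`∀ u v u' v' ((R u v ∧ R u' v') → (u ≠ v' ∧ v ≠ u'))`, with `u`, `v`, `u'`, `v'` being
`k`-tuples of variables. -/
noncomputable abbrev exclusion (k : ℕ) : Dependency where
  arity := k + k
  sentence := FirstOrder.Language.Formula.iAlls ((Fin k ⊕ Fin k) ⊕ (Fin k ⊕ Fin k))
    (let u := fun i => Sum.inr (Sum.inl (Sum.inl i))
     let v := fun i => Sum.inr (Sum.inl (Sum.inr i))
     let u' := fun i => Sum.inr (Sum.inr (Sum.inl i))
     let v' := fun i => Sum.inr (Sum.inr (Sum.inr i))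
     FirstOrder.Language.BoundedFormula.imp
      (relPair k u v ⊓ relPair k u' v')
      (tupleNe k u v' ⊓ tupleNe k v u'))

/-! ### Syntax of `FO(𝒟)` -/

/-- Formulas of `FO(𝒟)` over the signature `L`, in negation normal form, whose free variables
all belong to the finite set `V`. The variable symbols are indexed by the natural numbers, and a
quantifier may bind a variable that already belongs to `V`. -/
inductive TeamFormula (L : FirstOrder.Language.{u, v}) (𝒟 : Set Dependency) : Finset ℕ → Type (max u v)
  /-- `t₁ = t₂` -/
  | eq {V : Finset ℕ} (t₁ t₂ : L.Term V) : TeamFormula L 𝒟 V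
  /-- `t₁ ≠ t₂` -/
  | ne {V : Finset ℕ} (t₁ t₂ : L.Term V) : TeamFormula L 𝒟 V
  /-- `R t₁ … tₙ` -/
  | rel {V : Finset ℕ} {n : ℕ} (R : L.Relations n) (t : Fin n → L.Term V) : TeamFormula L 𝒟 V
  /-- `¬ R t₁ … tₙ` -/
  | nrel {V : Finset ℕ} {n : ℕ} (R : L.Relations n) (t : Fin n → L.Term V) : TeamFormula L 𝒟 V
  /-- The dependency atom `D t = [R : t] D(R)`, for `D ∈ 𝒟`. -/
  | dep {V : Finset ℕ} (D : Dependency) (hD : D ∈ 𝒟) (t : Fin D.arity → L.Term V) :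
      TeamFormula L 𝒟 V
  | and {V : Finset ℕ} (φ ψ : TeamFormula L 𝒟 V) : TeamFormula L 𝒟 V
  | or {V : Finset ℕ} (φ ψ : TeamFormula L 𝒟 V) : TeamFormula L 𝒟 V
  | ex {V : Finset ℕ} (x : ℕ) (φ : TeamFormula L 𝒟 (insert x V)) : TeamFormula L 𝒟 V
  | all {V : Finset ℕ} (x : ℕ) (φ : TeamFormula L 𝒟 (insert x V)) : TeamFormula L 𝒟 V

/-- Sentences of `FO(𝒟)`: formulas without free variables. -/
abbrev TeamSentence (L : FirstOrder.Language.{u, v}) (𝒟 : Set Dependency) : Type (max u v) :=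
  TeamFormula L 𝒟 ∅

/-! ### Team semantics -/

/-- Assignments over `M` with domain `V`. -/
abbrev Assignment (V : Finset ℕ) (M : Type w) : Type w := V → M

/-- The assignment `s[m/x]`, with domain `V ∪ {x}`. -/
def Assignment.update {V : Finset ℕ} {M : Type w} (s : Assignment V M) (x : ℕ) (m : M) :
    Assignment (insert x V) M :=
  fun y => if h : (y : ℕ) = x then m else s ⟨y, (Finset.mem_insert.mp y.2).resolve_left h⟩

/-- The unique assignment `ε` with empty domain. -/
def Assignment.empty (M : Type w) : Assignment ∅ M :=
  fun y => absurd y.2 (Finset.notMem_empty y.1)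

/-- Teams over `M` with domain `V`. -/
abbrev Team (V : Finset ℕ) (M : Type w) : Type w := Set (Assignment V M)

/-- The relation `X(t)`. -/
def Team.rel {L : FirstOrder.Language.{u, v}} {V : Finset ℕ} {M : Type w} [L.Structure M] (X : Team V M)
    {n : ℕ} (t : Fin n → L.Term V) : Set (Fin n → M) :=
  {a | ∃ s ∈ X, a = fun i => (t i).realize s}

/-- The supplementation `X[H/x]`; only the values of `H` on `X` matter. -/
def Team.supplement {V : Finset ℕ} {M : Type w} (X : Team V M) (x : ℕ)
    (H : Assignment V M → Set M) : Team (insert x V) M :=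
  {s' | ∃ s ∈ X, ∃ m ∈ H s, s' = Assignment.update s x m}

/-- The duplication `X[M/x]`. -/
def Team.duplicate {V : Finset ℕ} {M : Type w} (X : Team V M) (x : ℕ) : Team (insert x V) M :=
  {s' | ∃ s ∈ X, ∃ m : M, s' = Assignment.update s x m}

/-- `M ⊨_X φ` in (lax) team semantics. -/
def TeamFormula.Sat {L : FirstOrder.Language.{u, v}} {𝒟 : Set Dependency} {M : Type w} [L.Structure M] :
    {V : Finset ℕ} → TeamFormula L 𝒟 V → Team V M → Prop
  | _, .eq t₁ t₂, X => ∀ s ∈ X, t₁.realize s = t₂.realize s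
  | _, .ne t₁ t₂, X => ∀ s ∈ X, t₁.realize s ≠ t₂.realize s
  | _, .rel R t, X => ∀ s ∈ X, FirstOrder.Language.Structure.RelMap R (fun i => (t i).realize s)
  | _, .nrel R t, X => ∀ s ∈ X, ¬ FirstOrder.Language.Structure.RelMap R (fun i => (t i).realize s)
  | _, .dep D _ t, X => D.Holds (X.rel t)
  | _, .and φ ψ, X => φ.Sat X ∧ ψ.Sat X
  | V, .or φ ψ, X => ∃ Y Z : Team V M, X = Y ∪ Z ∧ φ.Sat Y ∧ ψ.Sat Z
  | V, .ex x φ, X => ∃ H : Assignment V M → Set M,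
      (∀ s ∈ X, (H s).Nonempty) ∧ φ.Sat (X.supplement x H)
  | _, .all x φ, X => φ.Sat (X.duplicate x)

/-- The sentence `φ` is true in `M`, that is, `M ⊨_{{ε}} φ`. -/
def TeamSentence.IsTrueIn {L : FirstOrder.Language.{u, v}} {𝒟 : Set Dependency} (φ : TeamSentence L 𝒟)
    (M : Type w) [L.Structure M] : Prop :=
  TeamFormula.Sat φ ({Assignment.empty M} : Team ∅ M)

end TeamLogic

namespace TeamLogic

open FirstOrder FirstOrder.Language

/-! ### The inclusion and exclusion dependencies -/

/-! The bridge is existential second-order logic whose quantified relations are all `k`-ary; the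
arity `k` is preserved in both translations.

From inclusion logic: the atom `x ⊆ y` holds in a team iff some `k`-ary relation `S` contains every
value of `x` and each of its elements is the value of `y` at some member of the team. This shape, a
condition on all members plus a witness condition for each tuple of each relation, survives all
connectives and quantifiers (`SkolemForm.of_formula`). On the one-element team of a sentence both
conditions become first order in the relations (`exists_predDefinable_iff_isTrueIn`).

To exclusion logic: put the first-order part in prenex form and let the team follow its quantifiers.
At a quantifier-free matrix, guess for each atom `t ∈ S` a member `p` and a non-member `q` of `S`,
and require that `t` equals the one that matches the guessed truth value. Exclusion atoms between
all `p` and all `q` that belong to the same relation make the guesses consistent across the whole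
team, so `S` is recovered as the set of values of the `p` (`teamDefinable_existsPred_of_isQF`). The
guesses exist only if `S` is neither empty nor full. Each relation is therefore assigned one of
three kinds, and a finite disjunction over the kinds ends the proof
(`exists_sentence_iff_exists_predRealize`). -/

theorem realize_relPair {M : Type w} {k : ℕ} {α : Type} (x y : Fin k → α)
    (S : Set (Fin (k + k) → M)) (s : α → M) :
    (letI := relStructure (k + k) S; (relPair k x y).Realize s) ↔
      Fin.append (s ∘ x) (s ∘ y) ∈ S := by
  let _ := relStructure (k + k) S
  have h : (fun i => s (Fin.append x y i)) = Fin.append (s ∘ x) (s ∘ y) := by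
    funext i
    refine Fin.addCases (fun i => ?_) (fun i => ?_) i <;>
      simp only [Fin.append_left, Fin.append_right, Function.comp]
  rw [← h]
  simp only [relPair, Formula.realize_rel, Term.realize_var]
  rfl

theorem realize_tupleNe {M : Type w} {k r : ℕ} {α : Type} (x y : Fin k → α)
    [(relSig r).Structure M] (s : α → M) :
    (tupleNe k (r := r) x y).Realize s ↔ s ∘ x ≠ s ∘ y := by
  simp [tupleNe, Formula.realize_not, Formula.realize_iInf, Formula.realize_equal, funext_iff]

theorem inclusion_holds_iff {M : Type w} {k : ℕ} (S : Set (Fin (k + k) → M)) :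
    (inclusion k).Holds S ↔
      ∀ a b : Fin k → M, Fin.append a b ∈ S → ∃ c, Fin.append c a ∈ S := by
  let _ := relStructure (k + k) S
  have key := fun (x y : Fin k → Empty ⊕ (Fin k ⊕ Fin k)) s => realize_relPair x y S s
  have key2 := fun (x y : Fin k → (Empty ⊕ (Fin k ⊕ Fin k)) ⊕ Fin k) s => realize_relPair x y S s
  unfold Dependency.Holds
  simp only [Sentence.Realize, Formula.realize_iAlls]
  constructor
  · intro h a b hab
    have := h (Sum.elim a b)
    rw [Formula.Realize, BoundedFormula.realize_imp] at this
    have := this ((key _ _ _).2 hab)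
    obtain ⟨c, hc⟩ := BoundedFormula.realize_iExs.1 this
    exact ⟨c, (key2 _ _ _).1 hc⟩
  · intro h i
    rw [Formula.Realize, BoundedFormula.realize_imp]
    intro hab
    obtain ⟨c, hc⟩ := h _ _ ((key _ _ _).1 hab)
    exact BoundedFormula.realize_iExs.2 ⟨c, (key2 _ _ _).2 hc⟩

theorem exclusion_holds_iff {M : Type w} {k : ℕ} (S : Set (Fin (k + k) → M)) :
    (exclusion k).Holds S ↔ ∀ a b a' b' : Fin k → M,
      Fin.append a b ∈ S → Fin.append a' b' ∈ S → a ≠ b' ∧ b ≠ a' := by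
  let _ := relStructure (k + k) S
  have key := fun (x y : Fin k → Empty ⊕ ((Fin k ⊕ Fin k) ⊕ (Fin k ⊕ Fin k))) s =>
    realize_relPair x y S s
  unfold Dependency.Holds
  simp only [Sentence.Realize, Formula.realize_iAlls]
  constructor
  · intro h a b a' b' hab hab'
    have := h (Sum.elim (Sum.elim a b) (Sum.elim a' b'))
    rw [Formula.Realize, BoundedFormula.realize_imp, BoundedFormula.realize_inf,
      BoundedFormula.realize_inf] at this
    have := this ⟨(key _ _ _).2 hab, (key _ _ _).2 hab'⟩
    exact ⟨(realize_tupleNe _ _ _).1 this.1, (realize_tupleNe _ _ _).1 this.2⟩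
  · intro h i
    rw [Formula.Realize, BoundedFormula.realize_imp, BoundedFormula.realize_inf,
      BoundedFormula.realize_inf]
    rintro ⟨hab, hab'⟩
    have := h _ _ _ _ ((key _ _ _).1 hab) ((key _ _ _).1 hab')
    exact ⟨(realize_tupleNe _ _ _).2 this.1, (realize_tupleNe _ _ _).2 this.2⟩

theorem append_mem_rel_iff {L : FirstOrder.Language.{u, v}} {V : Finset ℕ} {M : Type w}
    [L.Structure M] (X : Team V M) {k : ℕ} (x y : Fin k → L.Term V) (a b : Fin k → M) :
    Fin.append a b ∈ X.rel (Fin.append x y) ↔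
      ∃ s ∈ X, a = (fun i => (x i).realize s) ∧ b = fun i => (y i).realize s := by
  refine exists_congr fun s => and_congr_right fun _ => ?_
  constructor
  · intro h
    refine ⟨funext fun i => ?_, funext fun i => ?_⟩
    · simpa only [Fin.append_left] using congrFun h (Fin.castAdd k i)
    · simpa only [Fin.append_right] using congrFun h (Fin.natAdd k i)
  · rintro ⟨rfl, rfl⟩
    funext i
    refine Fin.addCases (fun i => ?_) (fun i => ?_) i <;>
      simp only [Fin.append_left, Fin.append_right]

theorem inclusion_holds_rel_iff {L : FirstOrder.Language.{u, v}} {V : Finset ℕ} {M : Type w}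
    [L.Structure M] (X : Team V M) {k : ℕ} (x y : Fin k → L.Term V) :
    (inclusion k).Holds (X.rel (Fin.append x y)) ↔
      ∀ s ∈ X, ∃ s' ∈ X, (fun i => (x i).realize s) = fun i => (y i).realize s' := by
  rw [inclusion_holds_iff]
  simp only [append_mem_rel_iff]
  constructor
  · intro h s hs
    obtain ⟨c, s', hs', -, h'⟩ := h _ _ ⟨s, hs, rfl, rfl⟩
    exact ⟨s', hs', h'⟩
  · rintro h _ _ ⟨s, hs, rfl, rfl⟩
    obtain ⟨s', hs', h'⟩ := h s hs
    exact ⟨_, s', hs', rfl, h'⟩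

/-- The two inequalities of the dependency are mirror images under exchange of the two pairs, so
together they say just that the value sets are disjoint. -/
theorem exclusion_holds_rel_iff {L : FirstOrder.Language.{u, v}} {V : Finset ℕ} {M : Type w}
    [L.Structure M] (X : Team V M) {k : ℕ} (x y : Fin k → L.Term V) :
    (exclusion k).Holds (X.rel (Fin.append x y)) ↔
      ∀ s ∈ X, ∀ s' ∈ X, (fun i => (x i).realize s) ≠ fun i => (y i).realize s' := by
  rw [exclusion_holds_iff]
  simp only [append_mem_rel_iff]
  constructor
  · intro h s hs s' hs'
    exact (h _ _ _ _ ⟨s, hs, rfl, rfl⟩ ⟨s', hs', rfl, rfl⟩).1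
  · rintro h _ _ _ _ ⟨s, hs, rfl, rfl⟩ ⟨s', hs', rfl, rfl⟩
    exact ⟨h s hs s' hs', (h s' hs' s hs).symm⟩

/-! ### Team properties definable in `FO(𝒟)` -/

/-- A property of teams over the variables `α` is definable in `FO(𝒟)` if, however `α` is
identified with a finite set of variable symbols, it is expressed by a formula in these variables
over all models with at least two elements. -/
def TeamDefinable (L : FirstOrder.Language.{u, v}) (𝒟 : Set Dependency) (α : Type)
    (P : ∀ (M : Type w) [L.Structure M], Set (α → M) → Prop) : Prop :=
  ∀ (V : Finset ℕ) (e : V ≃ α), ∃ ψ : TeamFormula L 𝒟 V,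
    ∀ (M : Type w) [L.Structure M] [Nontrivial M] (X : Set (α → M)),
      ψ.Sat {s : V → M | s ∘ e.symm ∈ X} ↔ P M X

namespace TeamDefinable

variable {L : FirstOrder.Language.{u, v}} {𝒟 : Set Dependency} {α β : Type}
  {P Q : ∀ (M : Type w) [L.Structure M], Set (α → M) → Prop}

theorem congr (hP : TeamDefinable L 𝒟 α P)
    (h : ∀ (M : Type w) [L.Structure M] [Nontrivial M] (X : Set (α → M)), P M X ↔ Q M X) :
    TeamDefinable L 𝒟 α Q := by
  intro V e
  obtain ⟨ψ, hψ⟩ := hP V e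
  exact ⟨ψ, fun M _ _ X => (hψ M X).trans (h M X)⟩

theorem equiv {P : ∀ (M : Type w) [L.Structure M], Set (β → M) → Prop} (f : α ≃ β)
    (hP : TeamDefinable L 𝒟 β P) :
    TeamDefinable L 𝒟 α fun M _ X => P M {s | s ∘ f ∈ X} := by
  intro V e
  obtain ⟨ψ, hψ⟩ := hP V (e.trans f)
  refine ⟨ψ, fun M _ _ X => ?_⟩
  refine Iff.trans ?_ (hψ M _)
  have : {s : V → M | s ∘ e.symm ∈ X} =
      {s | s ∘ (e.trans f).symm ∈ {s : β → M | s ∘ f ∈ X}} := by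
    ext s
    simp only [Set.mem_ofPred_eq]
    have : (s ∘ (e.trans f).symm) ∘ f = s ∘ e.symm := by funext; simp
    rw [this]
  rw [this]

theorem and (hP : TeamDefinable L 𝒟 α P) (hQ : TeamDefinable L 𝒟 α Q) :
    TeamDefinable L 𝒟 α fun M _ X => P M X ∧ Q M X := by
  intro V e
  obtain ⟨ψ, hψ⟩ := hP V e
  obtain ⟨χ, hχ⟩ := hQ V e
  exact ⟨.and ψ χ, fun M _ _ X => and_congr (hψ M X) (hχ M X)⟩

theorem or (hP : TeamDefinable L 𝒟 α P) (hQ : TeamDefinable L 𝒟 α Q) :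
    TeamDefinable L 𝒟 α fun M _ X => ∃ Y Z, X = Y ∪ Z ∧ P M Y ∧ Q M Z := by
  intro V e
  obtain ⟨ψ, hψ⟩ := hP V e
  obtain ⟨χ, hχ⟩ := hQ V e
  refine ⟨.or ψ χ, fun M _ _ X => ?_⟩
  constructor
  · rintro ⟨Y, Z, h, hY, hZ⟩
    have aux : ∀ Y : Set (V → M), {s : V → M | s ∘ e.symm ∈ {s : α → M | s ∘ e ∈ Y}} = Y := by
      intro Y
      ext s
      have : (s ∘ e.symm) ∘ e = s := by funext; simp
      simp only [Set.mem_ofPred_eq, this]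
    refine ⟨{s | s ∘ e ∈ Y}, {s | s ∘ e ∈ Z}, ?_, ?_, ?_⟩
    · ext s
      have : (s ∘ e) ∘ e.symm = s := by funext; simp
      have h' := Set.ext_iff.1 h (s ∘ e)
      simp only [Set.mem_union, Set.mem_ofPred_eq, this] at h' ⊢
      exact h'
    · rwa [← hψ M, aux]
    · rwa [← hχ M, aux]
  · rintro ⟨Y, Z, rfl, hY, hZ⟩
    exact ⟨{s | s ∘ e.symm ∈ Y}, {s | s ∘ e.symm ∈ Z}, rfl, (hψ M Y).2 hY, (hχ M Z).2 hZ⟩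

/-! ### Quantification over fresh variables and tuples -/

/-- A variable outside the finite set `V` overwrites nothing, so a supplemented assignment is
exactly an old one together with a value at `none`. -/
theorem exists_extend {V : Finset ℕ} (e : V ≃ α) :
    ∃ (x : ℕ) (e' : (insert x V : Finset ℕ) ≃ Option α),
      ∀ (M : Type w) (s : V → M) (m : M),
        (Assignment.update s x m ∘ e'.symm) ∘ some = s ∘ e.symm ∧
          (Assignment.update s x m ∘ e'.symm) none = m ∧
            ∀ t : ↥(insert x V : Finset ℕ) → M, (t ∘ e'.symm) ∘ some = s ∘ e.symm →
              (t ∘ e'.symm) none = m → t = Assignment.update s x m := by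
  obtain ⟨x, hx⟩ := Infinite.exists_notMem_finset V
  have hne : ∀ y : V, (y : ℕ) ≠ x := fun y h => hx (h ▸ y.2)
  let f : Option α → (insert x V : Finset ℕ) := fun o => o.elim
    ⟨x, Finset.mem_insert_self x V⟩ fun a => ⟨e.symm a, Finset.mem_insert_of_mem (e.symm a).2⟩
  have hf : Function.Bijective f := by
    constructor
    · rintro (_ | a) (_ | b) h
      · rfl
      · exact absurd (congrArg Subtype.val h).symm (hne _)
      · exact absurd (congrArg Subtype.val h) (hne _)
      · exact congrArg some (e.symm.injective (Subtype.ext (Subtype.mk.inj h)))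
    · rintro ⟨y, hy⟩
      rcases Finset.mem_insert.1 hy with rfl | hy'
      · exact ⟨none, rfl⟩
      · exact ⟨some (e ⟨y, hy'⟩), by simp [f]⟩
  have h1 : ∀ (M : Type w) (s : V → M) (m : M),
      (Assignment.update s x m ∘ f) ∘ some = s ∘ e.symm := by
    intro M s m
    funext a
    simp [Assignment.update, f, hne]
  have h2 : ∀ (M : Type w) (s : V → M) (m : M), (Assignment.update s x m ∘ f) none = m := by
    intro M s m
    simp [Assignment.update, f]
  refine ⟨x, (Equiv.ofBijective f hf).symm, fun M s m => ⟨h1 M s m, h2 M s m, ?_⟩⟩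
  intro t ht1 ht2
  have : t ∘ f = Assignment.update s x m ∘ f := by
    funext o
    rcases o with _ | a
    · exact ht2.trans (h2 M s m).symm
    · exact congrFun (ht1.trans (h1 M s m).symm) a
  funext y
  obtain ⟨o, rfl⟩ := hf.2 y
  exact congrFun this o

theorem ex {P : ∀ (M : Type w) [L.Structure M], Set (Option α → M) → Prop}
    (hP : TeamDefinable L 𝒟 (Option α) P) :
    TeamDefinable L 𝒟 α fun M _ X => ∃ H : (α → M) → Set M, (∀ s ∈ X, (H s).Nonempty) ∧
      P M {s | s ∘ some ∈ X ∧ s none ∈ H (s ∘ some)} := by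
  intro V e
  obtain ⟨x, e', he⟩ := exists_extend e
  obtain ⟨ψ, hψ⟩ := hP _ e'
  refine ⟨.ex x ψ, fun M _ _ X => ?_⟩
  have hc : ∀ s : α → M, (s ∘ e) ∘ e.symm = s := fun s => by funext; simp
  have hc' : ∀ s : V → M, (s ∘ e.symm) ∘ e = s := fun s => by funext; simp
  have key : ∀ (H : (V → M) → Set M), Team.supplement {s : V → M | s ∘ e.symm ∈ X} x H =
      {t | t ∘ e'.symm ∈ {s : Option α → M | s ∘ some ∈ X ∧ s none ∈ H ((s ∘ some) ∘ e)}} := by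
    intro H
    ext t
    constructor
    · rintro ⟨s, hs, m, hm, rfl⟩
      obtain ⟨h1, h2, -⟩ := he M s m
      refine ⟨?_, ?_⟩
      · rw [h1]; exact hs
      · rw [h1, h2, hc']; exact hm
    · rintro ⟨h1, h2⟩
      refine ⟨((t ∘ e'.symm) ∘ some) ∘ e, ?_, _, h2, ?_⟩
      · rw [Set.mem_ofPred_eq, hc]; exact h1
      · exact (he M _ _).2.2 t (hc _).symm rfl
  constructor
  · rintro ⟨H, hH, h⟩
    refine ⟨fun s => H (s ∘ e), fun s hs => hH _ ?_, ?_⟩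
    · rw [Set.mem_ofPred_eq, hc]; exact hs
    · rw [key, hψ M] at h
      exact h
  · rintro ⟨H, hH, h⟩
    refine ⟨fun s => H (s ∘ e.symm), fun s hs => hH _ hs, ?_⟩
    rw [key, hψ M]
    simpa only [hc] using h

theorem all {P : ∀ (M : Type w) [L.Structure M], Set (Option α → M) → Prop}
    (hP : TeamDefinable L 𝒟 (Option α) P) :
    TeamDefinable L 𝒟 α fun M _ X => P M {s | s ∘ some ∈ X} := by
  intro V e
  obtain ⟨x, e', he⟩ := exists_extend e
  obtain ⟨ψ, hψ⟩ := hP _ e'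
  refine ⟨.all x ψ, fun M _ _ X => ?_⟩
  refine Iff.trans ?_ (hψ M _)
  have : Team.duplicate {s : V → M | s ∘ e.symm ∈ X} x =
      {t | t ∘ e'.symm ∈ {s : Option α → M | s ∘ some ∈ X}} := by
    ext t
    constructor
    · rintro ⟨s, hs, m, rfl⟩
      obtain ⟨h1, -, -⟩ := he M s m
      rw [Set.mem_ofPred_eq, Set.mem_ofPred_eq, h1]
      exact hs
    · intro h1
      have hc : (((t ∘ e'.symm) ∘ some) ∘ e) ∘ e.symm = (t ∘ e'.symm) ∘ some := by
        funext; simp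
      refine ⟨((t ∘ e'.symm) ∘ some) ∘ e, ?_, (t ∘ e'.symm) none, ?_⟩
      · rw [Set.mem_ofPred_eq, hc]; exact h1
      · exact (he M _ _).2.2 t hc.symm rfl
  rw [← this]
  rfl

/-- The last of `n + 1` variables is split off. -/
def optionSumFin (α : Type) (n : ℕ) : Option (α ⊕ Fin n) ≃ α ⊕ Fin (n + 1) where
  toFun o := o.elim (Sum.inr (Fin.last n)) (Sum.map id Fin.castSucc)
  invFun := Sum.elim (some ∘ Sum.inl) fun i =>
    Fin.lastCases (motive := fun _ => Option (α ⊕ Fin n)) none (fun i => some (Sum.inr i)) i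
  left_inv := by rintro (_ | _ | _) <;> simp
  right_inv := by
    rintro (a | i)
    · rfl
    · refine Fin.lastCases ?_ (fun i => ?_) i <;> simp

theorem all_fin {n : ℕ} {P : ∀ (M : Type w) [L.Structure M], Set (α ⊕ Fin (n + 1) → M) → Prop}
    (hP : TeamDefinable L 𝒟 (α ⊕ Fin (n + 1)) P) :
    TeamDefinable L 𝒟 (α ⊕ Fin n) fun M _ X => P M {s | s ∘ Sum.map id Fin.castSucc ∈ X} :=
  all (equiv (optionSumFin α n) hP)

theorem ex_fin {n : ℕ} {P : ∀ (M : Type w) [L.Structure M], Set (α ⊕ Fin (n + 1) → M) → Prop}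
    (hP : TeamDefinable L 𝒟 (α ⊕ Fin (n + 1)) P) :
    TeamDefinable L 𝒟 (α ⊕ Fin n) fun M _ X => ∃ H : (α ⊕ Fin n → M) → Set M,
      (∀ s ∈ X, (H s).Nonempty) ∧ P M {s | s ∘ Sum.map id Fin.castSucc ∈ X ∧
        s (Sum.inr (Fin.last n)) ∈ H (s ∘ Sum.map id Fin.castSucc)} :=
  ex (equiv (optionSumFin α n) hP)

theorem comp_inr_eq_snoc {n : ℕ} {M : Type w} (s : α ⊕ Fin (n + 1) → M) :
    s ∘ Sum.inr = Fin.snoc ((s ∘ Sum.map id Fin.castSucc) ∘ Sum.inr) (s (Sum.inr (Fin.last n))) := by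
  funext i
  refine Fin.lastCases ?_ (fun i => ?_) i <;> simp

theorem exists_comp_castSucc {n : ℕ} {M : Type w} (s : α ⊕ Fin n → M) (m : M) :
    ∃ s' : α ⊕ Fin (n + 1) → M,
      s' ∘ Sum.map id Fin.castSucc = s ∧ s' (Sum.inr (Fin.last n)) = m := by
  refine ⟨(fun o : Option (α ⊕ Fin n) => o.elim m s) ∘ (optionSumFin α n).symm, ?_, ?_⟩
  · funext x
    exact congrArg (fun o : Option (α ⊕ Fin n) => o.elim m s)
      ((optionSumFin α n).symm_apply_apply (some x))
  · exact congrArg (fun o : Option (α ⊕ Fin n) => o.elim m s)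
      ((optionSumFin α n).symm_apply_apply none)

/-- Lax existential quantification over a tuple of variables. -/
theorem ex_tuple (B : Type) [Finite B] :
    ∀ {α : Type} {P : ∀ (M : Type w) [L.Structure M], Set (α ⊕ B → M) → Prop},
      TeamDefinable L 𝒟 (α ⊕ B) P →
      TeamDefinable L 𝒟 α fun M _ X => ∃ H : (α → M) → Set (B → M), (∀ s ∈ X, (H s).Nonempty) ∧
        P M {s | s ∘ Sum.inl ∈ X ∧ s ∘ Sum.inr ∈ H (s ∘ Sum.inl)} := by
  induction B using Finite.induction_empty_option with
  | of_equiv f ih =>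
    rename_i B C
    intro α P hP
    refine (ih (equiv (Equiv.sumCongr (Equiv.refl α) f) hP)).congr fun M _ _ X => ?_
    constructor
    · rintro ⟨H, hH, h⟩
      refine ⟨fun s => {b | b ∘ f ∈ H s}, fun s hs => ?_, ?_⟩
      · obtain ⟨b, hb⟩ := hH s hs
        refine ⟨b ∘ f.symm, ?_⟩
        have : (b ∘ f.symm) ∘ f = b := by funext; simp
        rw [Set.mem_ofPred_eq, this]
        exact hb
      · exact h
    · rintro ⟨H, hH, h⟩
      refine ⟨fun s => {b | b ∘ f.symm ∈ H s}, fun s hs => ?_, ?_⟩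
      · obtain ⟨b, hb⟩ := hH s hs
        refine ⟨b ∘ f, ?_⟩
        have : (b ∘ f) ∘ f.symm = b := by funext; simp
        rw [Set.mem_ofPred_eq, this]
        exact hb
      · convert h using 4 with s
        have : ((s ∘ (Equiv.sumCongr (Equiv.refl α) f)) ∘ Sum.inr) ∘ f.symm = s ∘ Sum.inr := by
          funext; simp
        change s ∘ Sum.inl ∈ X ∧
          ((s ∘ (Equiv.sumCongr (Equiv.refl α) f)) ∘ Sum.inr) ∘ f.symm ∈ H (s ∘ Sum.inl) ↔ _
        rw [this]
  | h_empty =>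
    intro α P hP
    refine (equiv (Equiv.sumEmpty α PEmpty).symm hP).congr fun M _ _ X => ?_
    -- There is only one empty tuple, so a nonempty set of them imposes no condition.
    have key : ∀ H : (α → M) → Set (PEmpty → M), (∀ s ∈ X, (H s).Nonempty) →
        {s : α ⊕ PEmpty → M | s ∘ (Equiv.sumEmpty α PEmpty).symm ∈ X} =
        {s | s ∘ Sum.inl ∈ X ∧ s ∘ Sum.inr ∈ H (s ∘ Sum.inl)} := by
      intro H hH
      ext s
      refine ⟨fun h => ⟨h, ?_⟩, fun h => h.1⟩
      obtain ⟨b, hb⟩ := hH _ h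
      rwa [Subsingleton.elim (s ∘ Sum.inr) b]
    constructor
    · intro h
      refine ⟨fun _ => Set.univ, fun _ _ => Set.univ_nonempty, ?_⟩
      rwa [← key (fun _ => Set.univ) fun _ _ => Set.univ_nonempty]
    · rintro ⟨H, hH, h⟩
      rwa [key H hH]
  | h_option ih =>
    rename_i B _
    intro α P hP
    let f : Option (α ⊕ B) ≃ α ⊕ Option B :=
      { toFun := fun o => o.elim (Sum.inr none) (Sum.map id some)
        invFun := Sum.elim (some ∘ Sum.inl) fun o => o.map Sum.inr
        left_inv := by rintro (_ | _ | _) <;> rfl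
        right_inv := by rintro (_ | _ | _) <;> rfl }
    refine (ih (ex (equiv f hP))).congr fun M _ _ X => ?_
    constructor
    · rintro ⟨H, hH, H', hH', h⟩
      refine ⟨fun s => {b | b ∘ some ∈ H s ∧ b none ∈ H' (Sum.elim s (b ∘ some))},
        fun s hs => ?_, ?_⟩
      · obtain ⟨b, hb⟩ := hH s hs
        obtain ⟨m, hm⟩ := hH' (Sum.elim s b) ⟨hs, hb⟩
        exact ⟨fun o => o.elim m b, hb, hm⟩
      · convert h using 1
        ext s
        have : Sum.elim (s ∘ Sum.inl) ((s ∘ Sum.inr) ∘ some) = (s ∘ f) ∘ some := by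
          funext o; rcases o with a | b <;> rfl
        simp only [Set.mem_ofPred_eq, this]
        constructor
        · rintro ⟨h1, h2, h3⟩; exact ⟨⟨h1, h2⟩, h3⟩
        · rintro ⟨⟨h1, h2⟩, h3⟩; exact ⟨h1, h2, h3⟩
    · rintro ⟨H, hH, h⟩
      -- Project the set of tuples to all but one coordinate, then choose for the last coordinate
      -- the fibre over the projection. Lax semantics is essential: a set-valued choice can
      -- reproduce any nonempty set of tuples.
      refine ⟨fun s => (fun b => b ∘ some) '' H s, fun s hs => (hH s hs).image _,
        fun t => {m | (fun o : Option B => o.elim m (t ∘ Sum.inr)) ∈ H (t ∘ Sum.inl)},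
        ?_, ?_⟩
      · rintro t ⟨h1, b, hb, hb'⟩
        refine ⟨b none, ?_⟩
        have : (fun o : Option B => o.elim (b none) (t ∘ Sum.inr)) = b := by
          funext o
          rcases o with _ | o
          · rfl
          · exact (congrFun hb' o).symm
        rw [Set.mem_ofPred_eq, this]
        exact hb
      · convert h using 1
        ext s
        have : (fun o : Option B => o.elim ((s ∘ f) none) (((s ∘ f) ∘ some) ∘ Sum.inr)) =
            s ∘ Sum.inr := by
          funext o; rcases o with _ | o <;> rfl
        simp only [Set.mem_ofPred_eq, this]
        constructor
        · rintro ⟨⟨h1, -⟩, h3⟩; exact ⟨h1, h3⟩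
        · rintro ⟨h1, h3⟩; exact ⟨⟨h1, s ∘ Sum.inr, h3, rfl⟩, h3⟩

/-- The atoms are evaluated on `V`-indexed teams through the identification of variables. -/
theorem forall_mem_iff {V : Finset ℕ} (e : V ≃ α) {M : Type w} (X : Set (α → M))
    (p : (α → M) → Prop) :
    (∀ s ∈ {s : V → M | s ∘ e.symm ∈ X}, p (s ∘ e.symm)) ↔ ∀ s ∈ X, p s := by
  constructor
  · intro h s hs
    have hc : (s ∘ e) ∘ e.symm = s := by funext; simp
    have := h (s ∘ e) (by rw [Set.mem_ofPred_eq, hc]; exact hs)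
    rwa [hc] at this
  · intro h s hs
    exact h _ hs

/-! ### First-order formulas and exclusion atoms -/

/-- The quantifier supplies a variable to write `x ≠ x` with, since `V` may be empty and `L` without
constants; the team stays nonempty because the domain is nonempty. -/
theorem forall_false : TeamDefinable.{u, v, w} L 𝒟 α fun _ _ X => ∀ s ∈ X, False := by
  intro V e
  let x : L.Term (insert 0 V : Finset ℕ) := .var ⟨0, Finset.mem_insert_self 0 V⟩
  refine ⟨.all 0 (.ne x x), fun M _ _ X => ?_⟩
  refine Iff.trans ?_ (forall_mem_iff e X _)
  constructor
  · intro h s hs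
    obtain ⟨m⟩ : Nonempty M := inferInstance
    exact h _ ⟨s, hs, m, rfl⟩ rfl
  · rintro h _ ⟨s, hs, m, rfl⟩
    exact (h s hs).elim

/-- First-order formulas are flat: a team satisfies one iff every member does. Both polarities are
carried through the induction because team formulas are in negation normal form while `χ` is built
from implication and `∀`. -/
theorem formula {n : ℕ} (χ : L.BoundedFormula α n) :
    (TeamDefinable.{u, v, w} L 𝒟 (α ⊕ Fin n) fun _ _ X =>
      ∀ s ∈ X, χ.Realize (s ∘ Sum.inl) (s ∘ Sum.inr)) ∧
    (TeamDefinable.{u, v, w} L 𝒟 (α ⊕ Fin n) fun _ _ X =>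
      ∀ s ∈ X, ¬ χ.Realize (s ∘ Sum.inl) (s ∘ Sum.inr)) := by
  have hel : ∀ {n : ℕ} {M : Type w} (s : α ⊕ Fin n → M),
      Sum.elim (s ∘ Sum.inl) (s ∘ Sum.inr) = s := fun s => Sum.elim_comp_inl_inr s
  induction χ with
  | falsum =>
    refine ⟨forall_false, fun V e => ?_⟩
    let x : L.Term (insert 0 V : Finset ℕ) := .var ⟨0, Finset.mem_insert_self 0 V⟩
    exact ⟨.all 0 (.eq x x), fun M _ _ X => ⟨fun _ _ _ h => h, fun _ _ _ => rfl⟩⟩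
  | equal t₁ t₂ =>
    constructor <;> intro V e
    · refine ⟨.eq (t₁.relabel e.symm) (t₂.relabel e.symm), fun M _ _ X => ?_⟩
      refine Iff.trans ?_ (forall_mem_iff e X _)
      simp only [TeamFormula.Sat, BoundedFormula.Realize, Term.realize_relabel, hel]
    · refine ⟨.ne (t₁.relabel e.symm) (t₂.relabel e.symm), fun M _ _ X => ?_⟩
      refine Iff.trans ?_ (forall_mem_iff e X _)
      simp only [TeamFormula.Sat, BoundedFormula.Realize, Term.realize_relabel, hel, ne_eq]
  | rel R t =>
    constructor <;> intro V e
    · refine ⟨.rel R fun i => (t i).relabel e.symm, fun M _ _ X => ?_⟩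
      refine Iff.trans ?_ (forall_mem_iff e X _)
      simp only [TeamFormula.Sat, BoundedFormula.Realize, Term.realize_relabel, hel]
    · refine ⟨.nrel R fun i => (t i).relabel e.symm, fun M _ _ X => ?_⟩
      refine Iff.trans ?_ (forall_mem_iff e X _)
      simp only [TeamFormula.Sat, BoundedFormula.Realize, Term.realize_relabel, hel]
  | imp χ₁ χ₂ ih₁ ih₂ =>
    constructor
    · refine (ih₁.2.or ih₂.1).congr fun M _ _ X => ?_
      simp only [BoundedFormula.realize_imp]
      constructor
      · rintro ⟨Y, Z, rfl, hY, hZ⟩ s (hs | hs) h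
        · exact (hY s hs h).elim
        · exact hZ s hs
      · intro h
        refine ⟨{s ∈ X | ¬ χ₁.Realize (s ∘ Sum.inl) (s ∘ Sum.inr)},
          {s ∈ X | χ₂.Realize (s ∘ Sum.inl) (s ∘ Sum.inr)}, ?_, fun s hs => hs.2,
          fun s hs => hs.2⟩
        ext s
        have := h s
        simp only [Set.mem_union, Set.mem_ofPred_eq]
        tauto
    · refine (ih₁.1.and ih₂.2).congr fun M _ _ X => ?_
      simp only [BoundedFormula.realize_imp, ← forall_and, Classical.not_imp]
  | all χ ih =>
    constructor
    · refine (all_fin ih.1).congr fun M _ _ X => ?_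
      simp only [BoundedFormula.realize_all]
      constructor
      · intro h s hs m
        obtain ⟨s', rfl, rfl⟩ := exists_comp_castSucc s m
        have := h s' hs
        rwa [comp_inr_eq_snoc] at this
      · intro h s hs
        rw [comp_inr_eq_snoc]
        exact h _ hs _
    · refine (ex_fin ih.2).congr fun M _ _ X => ?_
      simp only [BoundedFormula.realize_all, not_forall]
      constructor
      · rintro ⟨H, hH, h⟩ s hs
        obtain ⟨m, hm⟩ := hH s hs
        refine ⟨m, ?_⟩
        obtain ⟨s', rfl, rfl⟩ := exists_comp_castSucc s m
        have := h s' ⟨hs, hm⟩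
        rwa [comp_inr_eq_snoc] at this
      · intro h
        refine ⟨fun s => {m | ¬ χ.Realize (s ∘ Sum.inl) (Fin.snoc (s ∘ Sum.inr) m)}, h, ?_⟩
        rintro s ⟨-, hs⟩
        rw [comp_inr_eq_snoc]
        exact hs

theorem forall_realize (χ : L.Formula α) :
    TeamDefinable.{u, v, w} L 𝒟 α fun _ _ X => ∀ s ∈ X, χ.Realize s := by
  refine (equiv (Equiv.sumEmpty α (Fin 0)).symm (formula χ).1).congr fun M _ _ X => ?_
  constructor
  · intro h s hs
    have := h (Sum.elim s default) hs
    rwa [Formula.Realize, Subsingleton.elim default (Sum.elim s default ∘ Sum.inr)]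
  · intro h s hs
    rw [Subsingleton.elim (s ∘ Sum.inr) default]
    exact h _ hs

theorem exclusion {k : ℕ} (x y : Fin k → α) :
    TeamDefinable.{u, v, w} L {TeamLogic.exclusion k} α fun _ _ X =>
      ∀ s ∈ X, ∀ s' ∈ X, s ∘ x ≠ s' ∘ y := by
  intro V e
  refine ⟨.dep (TeamLogic.exclusion k) rfl
    (Fin.append (fun i => .var (e.symm (x i))) fun i => .var (e.symm (y i))), fun M _ _ X => ?_⟩
  refine (exclusion_holds_rel_iff _ _ _).trans ?_
  refine Iff.trans ?_ (forall_mem_iff e X _)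
  refine forall₂_congr fun s _ => ?_
  refine Iff.trans ?_ (forall_mem_iff e X _)
  rfl

theorem iInf {ι : Type} [Finite ι] {P : ι → ∀ (M : Type w) [L.Structure M], Set (α → M) → Prop}
    (hP : ∀ i, TeamDefinable L 𝒟 α (P i)) :
    TeamDefinable L 𝒟 α fun M _ X => ∀ i, P i M X := by
  classical
  have := Fintype.ofFinite ι
  suffices h : ∀ F : Finset ι, TeamDefinable L 𝒟 α fun M _ X => ∀ i ∈ F, P i M X from
    (h Finset.univ).congr fun M _ _ X => by simp
  intro F
  induction F using Finset.induction with
  | empty => exact (forall_realize ⊤).congr fun M _ _ X => by simp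
  | insert i F _ ih => exact ((hP i).and ih).congr fun M _ _ X => by simp

end TeamDefinable

/-! ### First order formulas with additional predicates -/

/-- The signature consisting of relation symbols of arity `k`, indexed by `ι`. -/
def predLang (k : ℕ) (ι : Type) : FirstOrder.Language.{0, 0} where
  Functions _ := Empty
  Relations n := PLift (n = k) × ι

/-- The relation symbol of `predLang k ι` with index `i`. -/
def predSym (k : ℕ) {ι : Type} (i : ι) : (predLang k ι).Relations k := ⟨⟨rfl⟩, i⟩

/-- The model over `predLang k ι` in which the symbol with index `i` is interpreted by `S i`. -/
abbrev predStructure {M : Type w} {k : ℕ} {ι : Type} (S : ι → Set (Fin k → M)) :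
    (predLang k ι).Structure M where
  funMap f _ := Empty.elim f
  RelMap h a := (fun i => a (Fin.cast h.1.down.symm i)) ∈ S h.2

/-- Satisfaction in the expansion of a model by the relations `S i`. -/
def PredRealize {L : FirstOrder.Language.{u, v}} {k : ℕ} {ι α : Type} {M : Type w} [L.Structure M]
    (S : ι → Set (Fin k → M)) {n : ℕ} (χ : (L.sum (predLang k ι)).BoundedFormula α n) (s : α → M)
    (xs : Fin n → M) : Prop :=
  letI := predStructure S
  χ.Realize s xs

/-- A property of assignments, depending on relations `S i`, is definable if it is expressed by a
first order formula over the signature expanded by symbols for these relations. -/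
def PredDefinable (L : FirstOrder.Language.{u, v}) (k : ℕ) (ι α : Type)
    (Q : ∀ (M : Type w) [L.Structure M], (ι → Set (Fin k → M)) → (α → M) → Prop) : Prop :=
  ∃ χ : (L.sum (predLang k ι)).Formula α, ∀ (M : Type w) [L.Structure M]
    (S : ι → Set (Fin k → M)) (s : α → M), PredRealize S χ s default ↔ Q M S s

namespace PredDefinable

variable {L : FirstOrder.Language.{u, v}} {k : ℕ} {ι κ α β : Type}
  {P Q : ∀ (M : Type w) [L.Structure M], (ι → Set (Fin k → M)) → (α → M) → Prop}

theorem congr (hP : PredDefinable L k ι α P)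
    (h : ∀ (M : Type w) [L.Structure M] S s, P M S s ↔ Q M S s) : PredDefinable L k ι α Q := by
  obtain ⟨χ, hχ⟩ := hP
  exact ⟨χ, fun M _ S s => (hχ M S s).trans (h M S s)⟩

theorem and (hP : PredDefinable L k ι α P) (hQ : PredDefinable L k ι α Q) :
    PredDefinable L k ι α fun M _ S s => P M S s ∧ Q M S s := by
  obtain ⟨χ, hχ⟩ := hP
  obtain ⟨ξ, hξ⟩ := hQ
  refine ⟨χ ⊓ ξ, fun M _ S s => ?_⟩
  let _ := predStructure S
  exact BoundedFormula.realize_inf.trans (and_congr (hχ M S s) (hξ M S s))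

theorem or (hP : PredDefinable L k ι α P) (hQ : PredDefinable L k ι α Q) :
    PredDefinable L k ι α fun M _ S s => P M S s ∨ Q M S s := by
  obtain ⟨χ, hχ⟩ := hP
  obtain ⟨ξ, hξ⟩ := hQ
  refine ⟨χ ⊔ ξ, fun M _ S s => ?_⟩
  let _ := predStructure S
  exact BoundedFormula.realize_sup.trans (or_congr (hχ M S s) (hξ M S s))

theorem not (hP : PredDefinable L k ι α P) :
    PredDefinable L k ι α fun M _ S s => ¬ P M S s := by
  obtain ⟨χ, hχ⟩ := hP
  refine ⟨χ.not, fun M _ S s => ?_⟩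
  let _ := predStructure S
  exact BoundedFormula.realize_not.trans (not_congr (hχ M S s))

theorem iInf [Finite κ]
    {P : κ → ∀ (M : Type w) [L.Structure M], (ι → Set (Fin k → M)) → (α → M) → Prop}
    (hP : ∀ i, PredDefinable L k ι α (P i)) :
    PredDefinable L k ι α fun M _ S s => ∀ i, P i M S s := by
  choose χ hχ using hP
  refine ⟨Formula.iInf χ, fun M _ S s => ?_⟩
  simp only [← hχ]
  let _ := predStructure S
  exact Formula.realize_iInf

theorem relabel (g : α → β) (hP : PredDefinable L k ι α P) :
    PredDefinable L k ι β fun M _ S s => P M S (s ∘ g) := by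
  obtain ⟨χ, hχ⟩ := hP
  refine ⟨χ.relabel g, fun M _ S s => ?_⟩
  refine Iff.trans ?_ (hχ M S (s ∘ g))
  let _ := predStructure S
  exact Formula.realize_relabel

theorem ex {P : ∀ (M : Type w) [L.Structure M], (ι → Set (Fin k → M)) → (α ⊕ β → M) → Prop}
    [Finite β] (hP : PredDefinable L k ι (α ⊕ β) P) :
    PredDefinable L k ι α fun M _ S s => ∃ b, P M S (Sum.elim s b) := by
  obtain ⟨χ, hχ⟩ := hP
  refine ⟨Formula.iExs β χ, fun M _ S s => ?_⟩
  simp only [← hχ]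
  let _ := predStructure S
  exact Formula.realize_iExs

theorem all {P : ∀ (M : Type w) [L.Structure M], (ι → Set (Fin k → M)) → (α ⊕ β → M) → Prop}
    [Finite β] (hP : PredDefinable L k ι (α ⊕ β) P) :
    PredDefinable L k ι α fun M _ S s => ∀ b, P M S (Sum.elim s b) :=
  hP.not.ex.not.congr fun M _ S s => by simp

theorem formula (χ : L.Formula α) :
    PredDefinable.{u, v, w} L k ι α fun _ _ _ s => χ.Realize s := by
  refine ⟨LHom.sumInl.onFormula χ, fun M _ S s => ?_⟩
  let _ := predStructure S
  exact LHom.realize_onFormula LHom.sumInl χ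

theorem mem (i : ι) (t : Fin k → L.Term α) :
    PredDefinable.{u, v, w} L k ι α fun _ _ S s => (fun j => (t j).realize s) ∈ S i := by
  refine ⟨Relations.formula (L := L.sum (predLang k ι)) (Sum.inr (predSym k i))
    fun j => LHom.sumInl.onTerm (t j), fun M _ S s => ?_⟩
  let _ := predStructure S
  refine Formula.realize_rel.trans ?_
  simp only [LHom.realize_onTerm]
  exact Iff.rfl

theorem reindex (f : ι → κ) (hP : PredDefinable L k ι α P) :
    PredDefinable L k κ α fun M _ S s => P M (S ∘ f) s := by
  obtain ⟨χ, hχ⟩ := hP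
  let g : predLang k ι →ᴸ predLang k κ := ⟨fun _ => Empty.elim, fun _ r => ⟨r.1, f r.2⟩⟩
  refine ⟨((LHom.id L).sumMap g).onFormula χ, fun M _ S s => ?_⟩
  refine Iff.trans ?_ (hχ M (S ∘ f) s)
  let _ := predStructure S
  let _ := predStructure (S ∘ f)
  have : g.IsExpansionOn M := ⟨fun f _ => Empty.elim f, fun _ _ => rfl⟩
  exact LHom.realize_onFormula ((LHom.id L).sumMap g) χ

end PredDefinable

/-! ### Inclusion logic in existential second order logic -/

theorem realize_update_relabel {V : Finset ℕ} (x : ℕ) :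
    ∃ g : ↥(insert x V : Finset ℕ) → V ⊕ Unit, ∀ (M : Type w) (s : Assignment V M) (m : Unit → M),
      Sum.elim s m ∘ g = Assignment.update s x (m ()) := by
  refine ⟨fun y => if h : (y : ℕ) = x then Sum.inr () else
    Sum.inl ⟨y, (Finset.mem_insert.mp y.2).resolve_left h⟩, fun M s m => ?_⟩
  funext y
  by_cases h : (y : ℕ) = x <;> simp [Assignment.update, h]

/-- The variable `x` may already lie in `V`; the relabelling sends it to the quantified slot in any
case, so the old value is overwritten. -/
theorem PredDefinable.ex_update {L : FirstOrder.Language.{u, v}} {k : ℕ} {ι β : Type} {V : Finset ℕ}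
    {x : ℕ} {P : ∀ (M : Type w) [L.Structure M],
      (ι → Set (Fin k → M)) → (↥(insert x V : Finset ℕ) ⊕ β → M) → Prop}
    (hP : PredDefinable L k ι (↥(insert x V : Finset ℕ) ⊕ β) P) :
    PredDefinable L k ι (V ⊕ β) fun M _ S s =>
      ∃ m, P M S (Sum.elim (Assignment.update (s ∘ Sum.inl) x m) (s ∘ Sum.inr)) := by
  obtain ⟨g, hg⟩ := realize_update_relabel (V := V) x
  let g' : ↥(insert x V : Finset ℕ) ⊕ β → (V ⊕ β) ⊕ Unit :=
    Sum.elim (fun y => Sum.map Sum.inl id (g y)) (Sum.inl ∘ Sum.inr)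
  have hg' : ∀ (M : Type w) (s : V ⊕ β → M) (m : Unit → M), Sum.elim s m ∘ g' =
      Sum.elim (Assignment.update (s ∘ Sum.inl) x (m ())) (s ∘ Sum.inr) := by
    intro M s m
    rw [← hg]
    funext y
    rcases y with y | b
    · simp only [Function.comp, Sum.elim_inl, g']
      rcases g y with a | c <;> rfl
    · rfl
  refine (hP.relabel g').ex.congr fun M _ S s => ?_
  simp only [hg']
  exact ⟨fun ⟨m, h⟩ => ⟨_, h⟩, fun ⟨m, h⟩ => ⟨fun _ => m, h⟩⟩

/-- A formula of `k`-ary inclusion logic is expressed by existentially quantified `k`-ary relations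
`S i`, a condition `F` on all assignments in the team, and, for every tuple in one of the relations,
a condition `G i` on some assignment in the team. -/
def SkolemForm {L : FirstOrder.Language.{u, v}} {k : ℕ} {V : Finset ℕ}
    (φ : TeamFormula L {inclusion k} V) : Prop :=
  ∃ (ι : Type) (_ : Finite ι)
    (F : ∀ (M : Type w) [L.Structure M], (ι → Set (Fin k → M)) → (V → M) → Prop)
    (G : ι → ∀ (M : Type w) [L.Structure M], (ι → Set (Fin k → M)) → (V ⊕ Fin k → M) → Prop),
    PredDefinable L k ι V F ∧ (∀ i, PredDefinable L k ι (V ⊕ Fin k) (G i)) ∧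
      ∀ (M : Type w) [L.Structure M] (X : Team V M), φ.Sat X ↔
        ∃ S : ι → Set (Fin k → M), (∀ s ∈ X, F M S s) ∧
          ∀ i, ∀ a ∈ S i, ∃ s ∈ X, G i M S (Sum.elim s a)

namespace SkolemForm

variable {L : FirstOrder.Language.{u, v}} {k : ℕ} {V : Finset ℕ}

theorem literal (φ : TeamFormula L {inclusion k} V) (χ : L.Formula V)
    (h : ∀ (M : Type w) [L.Structure M] (X : Team V M), φ.Sat X ↔ ∀ s ∈ X, χ.Realize s) :
    SkolemForm.{u, v, w} φ :=
  ⟨Empty, inferInstance, _, fun i => i.elim, .formula χ, fun i => i.elim, fun M _ X =>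
    (h M X).trans ⟨fun h => ⟨fun i => i.elim, h, fun i => i.elim⟩, fun ⟨_, h, _⟩ => h⟩⟩

theorem inclusion_atom (t : Fin (k + k) → L.Term V) :
    SkolemForm.{u, v, w} (.dep (inclusion k) rfl t : TeamFormula L {inclusion k} V) := by
  let x : Fin k → L.Term V := fun i => t (Fin.castAdd k i)
  let y : Fin k → L.Term V := fun i => t (Fin.natAdd k i)
  have ht : t = Fin.append x y := by
    funext i
    refine Fin.addCases (fun i => ?_) (fun i => ?_) i <;>
      simp only [Fin.append_left, Fin.append_right, x, y]
  refine ⟨Unit, inferInstance, _, _, .mem () x, fun _ => .iInf fun i => .formula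
    (((y i).relabel Sum.inl).equal (.var (Sum.inr i))), fun M _ X => ?_⟩
  refine Iff.trans (b := (inclusion k).Holds (X.rel (Fin.append x y))) (by rw [← ht]; rfl) ?_
  rw [inclusion_holds_rel_iff]
  simp only [Formula.realize_equal, Term.realize_relabel, Sum.elim_comp_inl, Term.realize_var,
    Sum.elim_inr]
  constructor
  · intro h
    -- The full value set of `y` is a suitable relation.
    refine ⟨fun _ => {a | ∃ s ∈ X, a = fun i => (y i).realize s}, h, ?_⟩
    rintro _ _ ⟨s, hs, rfl⟩
    exact ⟨s, hs, fun _ => rfl⟩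
  · rintro ⟨S, h, h'⟩ s hs
    obtain ⟨s', hs', h''⟩ := h' () _ (h s hs)
    exact ⟨s', hs', funext fun i => (h'' i).symm⟩

theorem and {φ ψ : TeamFormula L {inclusion k} V} (hφ : SkolemForm.{u, v, w} φ)
    (hψ : SkolemForm.{u, v, w} ψ) : SkolemForm.{u, v, w} (.and φ ψ) := by
  obtain ⟨ι, _, F, G, hF, hG, h⟩ := hφ
  obtain ⟨κ, _, F', G', hF', hG', h'⟩ := hψ
  refine ⟨ι ⊕ κ, inferInstance, _,
    fun i M _ S s => i.elim (fun i => G i M (S ∘ Sum.inl) s) fun i => G' i M (S ∘ Sum.inr) s,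
    (hF.reindex Sum.inl).and (hF'.reindex Sum.inr), ?_, fun M _ X => ?_⟩
  · rintro (i | i)
    · exact (hG i).reindex Sum.inl
    · exact (hG' i).reindex Sum.inr
  · refine (and_congr (h M X) (h' M X)).trans ?_
    constructor
    · rintro ⟨⟨S, hS, hS'⟩, T, hT, hT'⟩
      exact ⟨Sum.elim S T, fun s hs => ⟨hS s hs, hT s hs⟩, Sum.rec hS' hT'⟩
    · rintro ⟨S, hS, hS'⟩
      exact ⟨⟨S ∘ Sum.inl, fun s hs => (hS s hs).1, fun i => hS' (Sum.inl i)⟩,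
        S ∘ Sum.inr, fun s hs => (hS s hs).2, fun i => hS' (Sum.inr i)⟩

/-- The halves can be taken to be the sets of members that satisfy `F` and `F'`. A witness must lie
in the half of its own disjunct, whence the conjuncts `F` and `F'` in the witness conditions. -/
theorem or {φ ψ : TeamFormula L {inclusion k} V} (hφ : SkolemForm.{u, v, w} φ)
    (hψ : SkolemForm.{u, v, w} ψ) : SkolemForm.{u, v, w} (.or φ ψ) := by
  obtain ⟨ι, _, F, G, hF, hG, h⟩ := hφ
  obtain ⟨κ, _, F', G', hF', hG', h'⟩ := hψ
  refine ⟨ι ⊕ κ, inferInstance, _,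
    fun i M _ S s => i.elim
      (fun i => F M (S ∘ Sum.inl) (s ∘ Sum.inl) ∧ G i M (S ∘ Sum.inl) s)
      fun i => F' M (S ∘ Sum.inr) (s ∘ Sum.inl) ∧ G' i M (S ∘ Sum.inr) s,
    (hF.reindex Sum.inl).or (hF'.reindex Sum.inr), ?_, fun M _ X => ?_⟩
  · rintro (i | i)
    · exact ((hF.reindex Sum.inl).relabel Sum.inl).and ((hG i).reindex Sum.inl)
    · exact ((hF'.reindex Sum.inr).relabel Sum.inl).and ((hG' i).reindex Sum.inr)
  · constructor
    · rintro ⟨Y, Z, rfl, hY, hZ⟩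
      obtain ⟨S, hS, hS'⟩ := (h M Y).1 hY
      obtain ⟨T, hT, hT'⟩ := (h' M Z).1 hZ
      refine ⟨Sum.elim S T, ?_, ?_⟩
      · rintro s (hs | hs)
        · exact Or.inl (hS s hs)
        · exact Or.inr (hT s hs)
      · rintro (i | i) a ha
        · obtain ⟨s, hs, hs'⟩ := hS' i a ha
          exact ⟨s, Or.inl hs, hS s hs, hs'⟩
        · obtain ⟨s, hs, hs'⟩ := hT' i a ha
          exact ⟨s, Or.inr hs, hT s hs, hs'⟩
    · rintro ⟨S, hS, hS'⟩
      refine ⟨{s ∈ X | F M (S ∘ Sum.inl) s}, {s ∈ X | F' M (S ∘ Sum.inr) s}, ?_,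
        (h M _).2 ⟨S ∘ Sum.inl, fun s hs => hs.2, fun i a ha => ?_⟩,
        (h' M _).2 ⟨S ∘ Sum.inr, fun s hs => hs.2, fun i a ha => ?_⟩⟩
      · ext s
        exact ⟨fun hs => (hS s hs).imp (And.intro hs) (And.intro hs),
          fun hs => hs.elim And.left And.left⟩
      · obtain ⟨s, hs, hs', hs''⟩ := hS' (Sum.inl i) a ha
        exact ⟨s, ⟨hs, hs'⟩, hs''⟩
      · obtain ⟨s, hs, hs', hs''⟩ := hS' (Sum.inr i) a ha
        exact ⟨s, ⟨hs, hs'⟩, hs''⟩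

/-- Once the relations are fixed, the largest choice of values, all `m` that satisfy `F`, serves; a
witness must be one of the extensions so chosen, so it also has to satisfy `F`. -/
theorem ex {x : ℕ} {φ : TeamFormula L {inclusion k} (insert x V)} (hφ : SkolemForm.{u, v, w} φ) :
    SkolemForm.{u, v, w} (.ex x φ) := by
  obtain ⟨ι, _, F, G, hF, hG, h⟩ := hφ
  refine ⟨ι, inferInstance, fun M _ S s => ∃ m, F M S (Assignment.update s x m),
    fun i M _ S s => ∃ m, F M S (Assignment.update (s ∘ Sum.inl) x m) ∧
      G i M S (Sum.elim (Assignment.update (s ∘ Sum.inl) x m) (s ∘ Sum.inr)), ?_, ?_,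
    fun M _ X => ?_⟩
  · obtain ⟨g, hg⟩ := realize_update_relabel.{w} (V := V) x
    refine (hF.relabel g).ex.congr fun M _ S s => ?_
    simp only [hg]
    exact ⟨fun ⟨m, h⟩ => ⟨_, h⟩, fun ⟨m, h⟩ => ⟨fun _ => m, h⟩⟩
  · exact fun i => ((hF.relabel Sum.inl).and (hG i)).ex_update
  · constructor
    · rintro ⟨H, hH, hX⟩
      obtain ⟨S, hS, hS'⟩ := (h M _).1 hX
      refine ⟨S, fun s hs => ?_, fun i a ha => ?_⟩
      · obtain ⟨m, hm⟩ := hH s hs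
        exact ⟨m, hS _ ⟨s, hs, m, hm, rfl⟩⟩
      · obtain ⟨_, ⟨s, hs, m, hm, rfl⟩, hs'⟩ := hS' i a ha
        exact ⟨s, hs, m, hS _ ⟨s, hs, m, hm, rfl⟩, hs'⟩
    · rintro ⟨S, hS, hS'⟩
      refine ⟨fun s => {m | F M S (Assignment.update s x m)}, hS, (h M _).2 ⟨S, ?_, ?_⟩⟩
      · rintro _ ⟨s, hs, m, hm, rfl⟩
        exact hm
      · intro i a ha
        obtain ⟨s, hs, m, hm, hm'⟩ := hS' i a ha
        exact ⟨_, ⟨s, hs, m, hm, rfl⟩, hm'⟩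

theorem all {x : ℕ} {φ : TeamFormula L {inclusion k} (insert x V)} (hφ : SkolemForm.{u, v, w} φ) :
    SkolemForm.{u, v, w} (.all x φ) := by
  obtain ⟨ι, _, F, G, hF, hG, h⟩ := hφ
  refine ⟨ι, inferInstance, fun M _ S s => ∀ m, F M S (Assignment.update s x m),
    fun i M _ S s => ∃ m,
      G i M S (Sum.elim (Assignment.update (s ∘ Sum.inl) x m) (s ∘ Sum.inr)), ?_, ?_,
    fun M _ X => ?_⟩
  · obtain ⟨g, hg⟩ := realize_update_relabel.{w} (V := V) x
    refine (hF.relabel g).all.congr fun M _ S s => ?_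
    simp only [hg]
    exact ⟨fun h m => h fun _ => m, fun h m => h _⟩
  · exact fun i => (hG i).ex_update
  · refine (h M _).trans (exists_congr fun S => and_congr ?_ ?_)
    · constructor
      · exact fun hS s hs m => hS _ ⟨s, hs, m, rfl⟩
      · rintro hS _ ⟨s, hs, m, rfl⟩
        exact hS s hs m
    · refine forall₃_congr fun i a _ => ?_
      constructor
      · rintro ⟨_, ⟨s, hs, m, rfl⟩, hs'⟩
        exact ⟨s, hs, m, hs'⟩
      · rintro ⟨s, hs, m, hs'⟩
        exact ⟨_, ⟨s, hs, m, rfl⟩, hs'⟩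

theorem of_formula (φ : TeamFormula L {inclusion k} V) : SkolemForm.{u, v, w} φ := by
  induction φ with
  | eq t₁ t₂ =>
    exact literal _ (t₁.equal t₂) fun M _ X => by
      simp only [TeamFormula.Sat, Formula.realize_equal]
  | ne t₁ t₂ =>
    exact literal _ (t₁.equal t₂).not fun M _ X => by
      simp only [TeamFormula.Sat, Formula.realize_not, Formula.realize_equal, ne_eq]
  | rel R t =>
    exact literal _ (R.formula t) fun M _ X => by
      simp only [TeamFormula.Sat, Formula.realize_rel]
  | nrel R t =>
    exact literal _ (R.formula t).not fun M _ X => by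
      simp only [TeamFormula.Sat, Formula.realize_not, Formula.realize_rel]
  | dep D hD t =>
    obtain rfl := hD
    exact inclusion_atom t
  | and φ ψ ihφ ihψ => exact ihφ.and ihψ
  | or φ ψ ihφ ihψ => exact ihφ.or ihψ
  | ex x φ ih => exact ih.ex
  | all x φ ih => exact ih.all

end SkolemForm

/-- Every sentence of `k`-ary inclusion logic is equivalent to an existential second order sentence
quantifying relations of arity `k`. -/
theorem exists_predDefinable_iff_isTrueIn {L : FirstOrder.Language.{u, v}} {k : ℕ}
    (φ : TeamSentence L {inclusion k}) :
    ∃ (ι : Type) (_ : Finite ι) (χ : (L.sum (predLang k ι)).Formula (∅ : Finset ℕ)),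
      ∀ (M : Type w) [L.Structure M], φ.IsTrueIn M ↔
        ∃ S : ι → Set (Fin k → M), PredRealize S χ (Assignment.empty M) default := by
  obtain ⟨ι, _, F, G, hF, hG, h⟩ := SkolemForm.of_formula.{u, v, w} φ
  obtain ⟨χ, hχ⟩ := hF.and (.iInf fun i : ι =>
    (((PredDefinable.mem i fun j => .var (Sum.inr j)).not).or (hG i)).all)
  refine ⟨ι, inferInstance, χ, fun M _ => (h M _).trans (exists_congr fun S => ?_)⟩
  rw [hχ]
  -- The team has the single member `ε`, so both "all members" and "some member" mean evaluation at
  -- `ε`.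
  simp [← imp_iff_not_or]

/-! ### Existential second order logic in exclusion logic -/

variable {L : FirstOrder.Language.{u, v}} {k : ℕ} {ι α : Type}

/-! ### Formulas over the expanded signature -/

theorem predRealize_all {M : Type w} [L.Structure M] {S : ι → Set (Fin k → M)} {n : ℕ}
    {χ : (L.sum (predLang k ι)).BoundedFormula α (n + 1)} {s : α → M} {xs : Fin n → M} :
    PredRealize S χ.all s xs ↔ ∀ m, PredRealize S χ s (Fin.snoc xs m) :=
  Iff.rfl

theorem predRealize_ex {M : Type w} [L.Structure M] {S : ι → Set (Fin k → M)} {n : ℕ}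
    {χ : (L.sum (predLang k ι)).BoundedFormula α (n + 1)} {s : α → M} {xs : Fin n → M} :
    PredRealize S χ.ex s xs ↔ ∃ m, PredRealize S χ s (Fin.snoc xs m) := by
  let _ := predStructure S
  exact BoundedFormula.realize_ex

theorem exists_term_realize_eq (t : (L.sum (predLang k ι)).Term α) :
    ∃ t' : L.Term α, ∀ (M : Type w) [L.Structure M] (S : ι → Set (Fin k → M)) (s : α → M),
      (letI := predStructure S; t.realize s) = t'.realize s := by
  induction t with
  | var a => exact ⟨.var a, fun M _ S s => rfl⟩
  | func f ts ih =>
    choose ts' h using ih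
    rcases f with f | f
    · refine ⟨.func f ts', fun M _ S s => ?_⟩
      exact congrArg (Structure.funMap f) (funext fun i => h i M S s)
    · exact Empty.elim f

/-- A quantifier free formula over the expanded signature depends on the truth values of finitely
many atomic formulas that use the new symbols. -/
theorem exists_atoms_of_isQF {n : ℕ} {χ : (L.sum (predLang k ι)).BoundedFormula α n}
    (hχ : χ.IsQF) :
    ∃ (A : Type) (_ : Finite A) (r : A → ι) (t : A → Fin k → L.Term (α ⊕ Fin n))
      (τ : (A → Bool) → L.Formula (α ⊕ Fin n)),
      ∀ (M : Type w) [L.Structure M] (S : ι → Set (Fin k → M)) (s : α ⊕ Fin n → M) (e : A → Bool),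
        (∀ j, e j = true ↔ (fun i => (t j i).realize s) ∈ S (r j)) →
          (PredRealize S χ (s ∘ Sum.inl) (s ∘ Sum.inr) ↔ (τ e).Realize s) := by
  induction hχ with
  | falsum =>
    exact ⟨Empty, inferInstance, fun j => j.elim, fun j => j.elim, fun _ => ⊥,
      fun M _ S s e _ => Iff.rfl⟩
  | of_isAtomic h =>
    rcases h with ⟨t₁, t₂⟩ | ⟨R, ts⟩
    · obtain ⟨t₁', h₁⟩ := exists_term_realize_eq.{u, v, w} t₁
      obtain ⟨t₂', h₂⟩ := exists_term_realize_eq.{u, v, w} t₂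
      refine ⟨Empty, inferInstance, fun j => j.elim, fun j => j.elim, fun _ => t₁'.equal t₂',
        fun M _ S s e _ => ?_⟩
      rw [Formula.realize_equal, ← h₁ M S, ← h₂ M S]
      let _ := predStructure S
      refine (BoundedFormula.realize_bdEqual _ _).trans ?_
      rw [Sum.elim_comp_inl_inr]
    · choose ts' h using fun i => exists_term_realize_eq.{u, v, w} (ts i)
      rcases R with R | R
      · refine ⟨Empty, inferInstance, fun j => j.elim, fun j => j.elim, fun _ => R.formula ts',
          fun M _ S s e _ => ?_⟩
        simp only [Formula.realize_rel, ← h _ M S]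
        let _ := predStructure S
        refine BoundedFormula.realize_rel.trans ?_
        rw [Sum.elim_comp_inl_inr]
        exact Iff.rfl
      · obtain ⟨⟨rfl⟩, i⟩ := R
        -- An atom in a new symbol is replaced by its supposed truth value.
        refine ⟨Unit, inferInstance, fun _ => i, fun _ => ts', fun e => if e () then ⊤ else ⊥,
          fun M _ S s e he => ?_⟩
        have : PredRealize S (Relations.boundedFormula
            (L := L.sum (predLang _ ι)) (Sum.inr (⟨⟨rfl⟩, i⟩ : (predLang _ ι).Relations _)) ts)
            (s ∘ Sum.inl) (s ∘ Sum.inr) ↔ (fun j => (ts' j).realize s) ∈ S i := by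
          simp only [← h _ M S]
          let _ := predStructure S
          refine BoundedFormula.realize_rel.trans ?_
          rw [Sum.elim_comp_inl_inr]
          exact Iff.rfl
        rw [this, ← he ()]
        rcases he : e () with _ | _ <;> simp [he]
  | imp _ _ ih₁ ih₂ =>
    obtain ⟨A, _, r, t, τ, h⟩ := ih₁
    obtain ⟨A', _, r', t', τ', h'⟩ := ih₂
    refine ⟨A ⊕ A', inferInstance, Sum.elim r r', Sum.elim t t',
      fun e => (τ (e ∘ Sum.inl)).imp (τ' (e ∘ Sum.inr)), fun M _ S s e he => ?_⟩
    refine Iff.trans ?_ (imp_congr (h M S s (e ∘ Sum.inl) fun j => he (Sum.inl j))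
      (h' M S s (e ∘ Sum.inr) fun j => he (Sum.inr j)))
    exact Iff.rfl

/-! ### Guessing members and non-members of the relations -/

/-- The relation `S` is of the kind `c`: it is full, or empty, or neither of these. -/
def HasKind {M : Type w} (S : Set (Fin k → M)) (c : Option Bool) : Prop :=
  match c with
  | none => S.Nonempty ∧ Sᶜ.Nonempty
  | some b => S = {_a | b = true}

theorem exists_hasKind {M : Type w} (S : Set (Fin k → M)) : ∃ c, HasKind S c := by
  rcases S.eq_empty_or_nonempty with rfl | h
  · exact ⟨some false, by simp [HasKind]⟩
  rcases Sᶜ.eq_empty_or_nonempty with h' | h'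
  · exact ⟨some true, by simpa [HasKind, Set.compl_empty_iff] using h'⟩
  · exact ⟨none, h, h'⟩

/-- Nonempty teams satisfy `χ` for some common choice of relations of the given kinds. -/
def ExistsPred {n : ℕ} (χ : (L.sum (predLang k ι)).BoundedFormula α n) (c : ι → Option Bool)
    (M : Type w) [L.Structure M] (X : Set (α ⊕ Fin n → M)) : Prop :=
  X.Nonempty → ∃ S : ι → Set (Fin k → M), (∀ i, HasKind (S i) (c i)) ∧
    ∀ s ∈ X, PredRealize S χ (s ∘ Sum.inl) (s ∘ Sum.inr)

/-- With values `p`, `q` guessed for members and non-members of a relation of kind `c`, the formula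
says that the membership of the tuple `t` has the truth value `b`. -/
noncomputable def guessFormula {β : Type} (t : Fin k → L.Term β) (p q : Fin k → β) :
    Option Bool → Bool → L.Formula β
  | none, true => Formula.iInf fun i => (Term.var (p i)).equal (t i)
  | none, false => Formula.iInf fun i => (Term.var (q i)).equal (t i)
  | some b, b' => if b = b' then ⊤ else ⊥

/-- Exclusion atoms compare guesses made at different assignments, which is what turns guesses local
to each assignment into one relation common to the whole team. -/
theorem teamDefinable_existsPred_of_isQF [Finite ι] (c : ι → Option Bool) {n : ℕ}
    {χ : (L.sum (predLang k ι)).BoundedFormula α n} (hχ : χ.IsQF) :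
    TeamDefinable.{u, v, w} L {exclusion k} (α ⊕ Fin n) (ExistsPred χ c) := by
  obtain ⟨A, _, r, t, τ, h⟩ := exists_atoms_of_isQF.{u, v, w} hχ
  -- One pair of guesses for each atom, and an extra pair for each relation, so that a relation
  -- occurring in no atom still receives a member and a non-member.
  let ρ : A ⊕ ι → ι := Sum.elim r id
  let γ : Type := (α ⊕ Fin n) ⊕ (A ⊕ ι) × Bool × Fin k
  let p : A ⊕ ι → Fin k → γ := fun j i => Sum.inr (j, true, i)
  let q : A ⊕ ι → Fin k → γ := fun j i => Sum.inr (j, false, i)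
  let matrix : L.Formula γ := Formula.iSup fun e : A → Bool =>
    ((τ e).relabel Sum.inl) ⊓ Formula.iInf fun j =>
      guessFormula (fun i => (t j i).relabel Sum.inl) (p (Sum.inl j)) (q (Sum.inl j)) (c (r j)) (e j)
  have hmatrix : ∀ (M : Type w) [L.Structure M] (s : γ → M), matrix.Realize s ↔
      ∃ e : A → Bool, (τ e).Realize (s ∘ Sum.inl) ∧ ∀ j, (c (r j) = some (e j) ∨ c (r j) = none ∧
        (if e j then s ∘ p (Sum.inl j) else s ∘ q (Sum.inl j)) =
          fun i => (t j i).realize (s ∘ Sum.inl)) := by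
    intro M _ s
    simp only [matrix, Formula.realize_iSup, Formula.realize_inf, Formula.realize_iInf,
      Formula.realize_relabel]
    refine exists_congr fun e => and_congr_right fun _ => forall_congr' fun j => ?_
    rcases c (r j) with _ | b
    · cases e j <;> simp [guessFormula, Formula.realize_iInf, Formula.realize_equal,
        Term.realize_relabel, funext_iff]
    · by_cases hb : b = e j <;> simp [guessFormula, hb]
  have hdef : TeamDefinable.{u, v, w} L {exclusion k} γ fun M _ X =>
      (∀ jj : {jj : (A ⊕ ι) × (A ⊕ ι) // ρ jj.1 = ρ jj.2 ∧ c (ρ jj.1) = none},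
        ∀ s ∈ X, ∀ s' ∈ X, s ∘ p jj.1.1 ≠ s' ∘ q jj.1.2) ∧ ∀ s ∈ X, matrix.Realize s :=
    (TeamDefinable.iInf fun jj => .exclusion _ _).and (.forall_realize matrix)
  refine (TeamDefinable.ex_tuple _ hdef).congr fun M _ _ X => ?_
  constructor
  · rintro ⟨H, hH, hex, hm⟩ ⟨s₀, hs₀⟩
    obtain ⟨b₀, hb₀⟩ := hH s₀ hs₀
    let X' : Set (γ → M) := {s | s ∘ Sum.inl ∈ X ∧ s ∘ Sum.inr ∈ H (s ∘ Sum.inl)}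
    have hmem : ∀ s ∈ X, ∀ b ∈ H s, Sum.elim s b ∈ X' := fun s hs b hb => ⟨hs, hb⟩
    -- For the kind `none` the relation consists of all values of the positive guesses; by exclusion
    -- no negative guess falls in it.
    let S : ι → Set (Fin k → M) := fun i =>
      {a | c i = some true ∨ c i = none ∧ ∃ j, ρ j = i ∧ ∃ s ∈ X', s ∘ p j = a}
    refine ⟨S, fun i => ?_, fun s hs => ?_⟩
    · rcases hc : c i with _ | b
      · refine ⟨⟨Sum.elim s₀ b₀ ∘ p (Sum.inr i), Or.inr ⟨hc, Sum.inr i, rfl, _, hmem _ hs₀ _ hb₀,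
          rfl⟩⟩, Sum.elim s₀ b₀ ∘ q (Sum.inr i), ?_⟩
        rintro (h | ⟨-, j, hj, s, hs, hs'⟩)
        · simp [hc] at h
        · exact hex ⟨(j, Sum.inr i), hj, by rw [hj, hc]⟩ s hs _ (hmem _ hs₀ _ hb₀) hs'
      · simp [HasKind, S, hc]
    · obtain ⟨b, hb⟩ := hH s hs
      obtain ⟨e, he, hl⟩ := (hmatrix M _).1 (hm _ (hmem s hs b hb))
      -- The guessed truth values are correct for `S`: a term equal to a positive guess lies in `S`,
      -- and one equal to a negative guess is kept out by the exclusions.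
      refine (h M S s e fun j => ?_).2 he
      rcases hl j with hc | ⟨hc, hj⟩
      · simp [S, hc]
      · change _ = (fun i => (t j i).realize s) at hj
        cases hej : e j
        · rw [hej, if_neg (by simp)] at hj
          rw [← hj]
          refine ⟨fun h => by simp at h, ?_⟩
          rintro (h | ⟨-, j', hj', s', hs', h⟩)
          · simp [hc] at h
          · exact (hex ⟨(j', Sum.inl j), hj', by rw [hj', hc]⟩ s' hs' _ (hmem s hs b hb) h).elim
        · rw [hej, if_pos rfl] at hj
          rw [← hj]
          exact ⟨fun _ => Or.inr ⟨hc, Sum.inl j, rfl, _, hmem s hs b hb, rfl⟩, fun _ => rfl⟩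
  · intro hX
    rcases X.eq_empty_or_nonempty with rfl | hne
    · exact ⟨fun _ => ∅, fun s hs => hs.elim, fun _ s hs => hs.1.elim, fun s hs => hs.1.elim⟩
    obtain ⟨S, hS, hχ⟩ := hX hne
    classical
    refine ⟨fun s => {b | ∀ j, c (ρ j) = none →
      ((fun i => b (j, true, i)) ∈ S (ρ j) ∧ (fun i => b (j, false, i)) ∉ S (ρ j)) ∧
      ∀ j', j = Sum.inl j' →
        (if (fun i => (t j' i).realize s) ∈ S (r j') then fun i => b (j, true, i)
          else fun i => b (j, false, i)) = fun i => (t j' i).realize s}, fun s _ => ?_, ?_, ?_⟩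
    · have : ∀ j : A ⊕ ι, ∃ x y : Fin k → M, c (ρ j) = none → (x ∈ S (ρ j) ∧ y ∉ S (ρ j)) ∧
          ∀ j', j = Sum.inl j' → (if (fun i => (t j' i).realize s) ∈ S (r j') then x else y) =
            fun i => (t j' i).realize s := by
        intro j
        obtain ⟨m⟩ : Nonempty M := inferInstance
        rcases hc : c (ρ j) with _ | b
        · have hk := hS (ρ j)
          rw [hc] at hk
          obtain ⟨⟨x, hx⟩, y, hy⟩ := hk
          rcases j with j | i
          · by_cases hj : (fun i => (t j i).realize s) ∈ S (r j)
            · refine ⟨_, y, fun _ => ⟨⟨hj, hy⟩, ?_⟩⟩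
              rintro j' ⟨⟩
              rw [if_pos hj]
            · refine ⟨x, _, fun _ => ⟨⟨hx, hj⟩, ?_⟩⟩
              rintro j' ⟨⟩
              rw [if_neg hj]
          · exact ⟨x, y, fun _ => ⟨⟨hx, hy⟩, fun j' h => by simp at h⟩⟩
        · exact ⟨fun _ => m, fun _ => m, fun h => by simp at h⟩
      choose x y hxy using this
      exact ⟨fun z => bif z.2.1 then x z.1 z.2.2 else y z.1 z.2.2, hxy⟩
    · rintro ⟨⟨j, j'⟩, hj, hc⟩ s ⟨-, hs⟩ s' ⟨-, hs'⟩ heq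
      have h1 := (hs j hc).1.1
      have h2 := (hs' j' (hj ▸ hc)).1.2
      apply h2
      rw [← show ρ j = ρ j' from hj]
      change s ∘ p j ∈ S (ρ j) at h1
      rw [show s ∘ p j = s' ∘ q j' from heq] at h1
      exact h1
    · rintro s ⟨hs, hs'⟩
      rw [hmatrix]
      let e : A → Bool := fun j => decide ((fun i => (t j i).realize (s ∘ Sum.inl)) ∈ S (r j))
      refine ⟨e, (h M S _ e fun j => by simp [e]).1 (hχ _ hs), fun j => ?_⟩
      rcases hc : c (r j) with _ | b
      · refine Or.inr ⟨rfl, ?_⟩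
        have := (hs' (Sum.inl j) hc).2 j rfl
        simp only [e, decide_eq_true_eq]
        exact this
      · refine Or.inl ?_
        have hk := hS (r j)
        rw [hc] at hk
        change S (r j) = _ at hk
        cases b <;> simp [e, hk]

/-- The relations are common to all members of the team, so they are in effect chosen before the
quantifiers of `χ`, although the formula guesses them only at the matrix. -/
theorem teamDefinable_existsPred_of_isPrenex [Finite ι] (c : ι → Option Bool) {n : ℕ}
    {χ : (L.sum (predLang k ι)).BoundedFormula α n} (hχ : χ.IsPrenex) :
    TeamDefinable.{u, v, w} L {exclusion k} (α ⊕ Fin n) (ExistsPred χ c) := by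
  induction hχ with
  | of_isQF h => exact teamDefinable_existsPred_of_isQF c h
  | all _ ih =>
    refine (TeamDefinable.all_fin ih).congr fun M _ _ X => imp_congr ?_ ?_
    · constructor
      · rintro ⟨s, hs⟩
        exact ⟨_, hs⟩
      · rintro ⟨s, hs⟩
        obtain ⟨m⟩ : Nonempty M := inferInstance
        obtain ⟨s', rfl, -⟩ := TeamDefinable.exists_comp_castSucc s m
        exact ⟨s', hs⟩
    · refine exists_congr fun S => and_congr_right fun _ => ?_
      constructor
      · intro h s hs
        refine predRealize_all.2 fun m => ?_
        obtain ⟨s', rfl, rfl⟩ := TeamDefinable.exists_comp_castSucc s m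
        have := h s' hs
        rwa [TeamDefinable.comp_inr_eq_snoc] at this
      · intro h s hs
        rw [TeamDefinable.comp_inr_eq_snoc]
        exact predRealize_all.1 (h _ hs) _
  | ex _ ih =>
    refine (TeamDefinable.ex_fin ih).congr fun M _ _ X => ?_
    constructor
    · rintro ⟨H, hH, h⟩ ⟨s₀, hs₀⟩
      obtain ⟨m₀, hm₀⟩ := hH s₀ hs₀
      obtain ⟨s₀', rfl, rfl⟩ := TeamDefinable.exists_comp_castSucc s₀ m₀
      obtain ⟨S, hS, h⟩ := h ⟨s₀', hs₀, hm₀⟩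
      refine ⟨S, hS, fun s hs => predRealize_ex.2 ?_⟩
      obtain ⟨m, hm⟩ := hH s hs
      refine ⟨m, ?_⟩
      obtain ⟨s', rfl, rfl⟩ := TeamDefinable.exists_comp_castSucc s m
      have := h s' ⟨hs, hm⟩
      rwa [TeamDefinable.comp_inr_eq_snoc] at this
    · intro hX
      -- On the empty team `ExistsPred` yields no relations, but there is also nothing to choose.
      rcases X.eq_empty_or_nonempty with rfl | hne
      · exact ⟨fun _ => ∅, fun s hs => hs.elim, fun ⟨s, hs, _⟩ => hs.elim⟩
      obtain ⟨S, hS, h⟩ := hX hne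
      refine ⟨fun s => {m | PredRealize S _ (s ∘ Sum.inl) (Fin.snoc (s ∘ Sum.inr) m)},
        fun s hs => predRealize_ex.1 (h s hs), fun _ => ⟨S, hS, ?_⟩⟩
      rintro s ⟨-, hs⟩
      rw [TeamDefinable.comp_inr_eq_snoc]
      exact hs

/-! ### Sentences and the disjunction over kinds -/

/-- Satisfaction by the empty team is recorded because a disjunction is proved from one disjunct by
giving the other the empty team. -/
theorem exists_sentence_iff_existsPred [Finite ι]
    (χ : (L.sum (predLang k ι)).Formula (∅ : Finset ℕ)) (c : ι → Option Bool) :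
    ∃ ψ : TeamSentence L {exclusion k}, ∀ (M : Type w) [L.Structure M] [Nontrivial M],
      (ψ.IsTrueIn M ↔ ∃ S : ι → Set (Fin k → M), (∀ i, HasKind (S i) (c i)) ∧
        PredRealize S χ (Assignment.empty M) default) ∧ ψ.Sat (∅ : Team ∅ M) := by
  obtain ⟨ψ, hψ⟩ := teamDefinable_existsPred_of_isPrenex.{u, v, w} c χ.toPrenex_isPrenex ∅
    (Equiv.sumEmpty _ (Fin 0)).symm
  refine ⟨ψ, fun M _ _ => ⟨?_, (hψ M ∅).2 fun ⟨_, h⟩ => h.elim⟩⟩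
  have huniv : ({Assignment.empty M} : Team ∅ M) = Set.univ :=
    Set.eq_univ_of_forall fun s => Subsingleton.elim _ _
  refine Iff.trans ?_ ((hψ M Set.univ).trans ?_)
  · rw [TeamSentence.IsTrueIn, huniv]
    exact Iff.rfl
  · have hs : ∀ (S : ι → Set (Fin k → M)) (s : (∅ : Finset ℕ) ⊕ Fin 0 → M),
        PredRealize S χ.toPrenex (s ∘ Sum.inl) (s ∘ Sum.inr) ↔
          PredRealize S χ (Assignment.empty M) default := by
      intro S s
      rw [Subsingleton.elim (s ∘ Sum.inl) (Assignment.empty M),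
        Subsingleton.elim (s ∘ Sum.inr) default]
      let _ := predStructure S
      exact BoundedFormula.realize_toPrenex χ
    have hne : (Set.univ : Set ((∅ : Finset ℕ) ⊕ Fin 0 → M)).Nonempty :=
      ⟨Sum.elim (Assignment.empty M) default, trivial⟩
    constructor
    · intro h
      obtain ⟨S, hS, h⟩ := h hne
      exact ⟨S, hS, (hs S _).1 (h _ hne.some_mem)⟩
    · rintro ⟨S, hS, h⟩ -
      exact ⟨S, hS, fun s _ => (hs S s).2 h⟩

/-- Every existential second order sentence quantifying relations of arity `k` is equivalent to a
sentence of `k`-ary exclusion logic. -/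
theorem exists_sentence_iff_exists_predRealize [Finite ι]
    (χ : (L.sum (predLang k ι)).Formula (∅ : Finset ℕ)) :
    ∃ ψ : TeamSentence L {exclusion k}, ∀ (M : Type w) [L.Structure M] [Nontrivial M],
      ψ.IsTrueIn M ↔ ∃ S : ι → Set (Fin k → M),
        PredRealize S χ (Assignment.empty M) default := by
  classical
  suffices h : ∀ C : Finset (ι → Option Bool), ∃ ψ : TeamSentence L {exclusion k},
      ∀ (M : Type w) [L.Structure M] [Nontrivial M],
        (ψ.IsTrueIn M ↔ ∃ c ∈ C, ∃ S : ι → Set (Fin k → M), (∀ i, HasKind (S i) (c i)) ∧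
          PredRealize S χ (Assignment.empty M) default) ∧ ψ.Sat (∅ : Team ∅ M) by
    have := Fintype.ofFinite (ι → Option Bool)
    obtain ⟨ψ, hψ⟩ := h Finset.univ
    refine ⟨ψ, fun M _ _ => (hψ M).1.trans ?_⟩
    constructor
    · rintro ⟨c, -, S, -, h⟩
      exact ⟨S, h⟩
    · rintro ⟨S, h⟩
      choose c hc using fun i => exists_hasKind (S i)
      exact ⟨c, Finset.mem_univ c, S, hc, h⟩
  intro C
  induction C using Finset.induction with
  | empty =>
    obtain ⟨ψ, hψ⟩ := TeamDefinable.forall_false.{u, v, w} (L := L) (𝒟 := {exclusion k}) ∅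
      (Equiv.refl _)
    exact ⟨ψ, fun M _ _ => ⟨iff_of_false (fun h => (hψ M {Assignment.empty M}).1 h _ rfl) (by simp),
      (hψ M ∅).2 fun _ h => h.elim⟩⟩
  | insert c C _ ih =>
    obtain ⟨ψ₁, h₁⟩ := exists_sentence_iff_existsPred.{u, v, w} χ c
    obtain ⟨ψ₂, h₂⟩ := ih
    refine ⟨.or ψ₁ ψ₂, fun M _ _ => ⟨?_, ∅, ∅, (Set.union_empty _).symm, (h₁ M).2, (h₂ M).2⟩⟩
    rw [Finset.exists_mem_insert, ← (h₁ M).1, ← (h₂ M).1]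
    constructor
    · rintro ⟨Y, Z, h, hY, hZ⟩
      -- Whichever part contains `ε` is the whole one-element team, so on sentences team disjunction
      -- is ordinary disjunction.
      have hmem : Assignment.empty M ∈ Y ∪ Z := h ▸ rfl
      rcases hmem with hm | hm
      · have : Y = {Assignment.empty M} := Set.Subset.antisymm
          (h ▸ Set.subset_union_left) (Set.singleton_subset_iff.2 hm)
        subst this
        exact Or.inl hY
      · have : Z = {Assignment.empty M} := Set.Subset.antisymm
          (h ▸ Set.subset_union_right) (Set.singleton_subset_iff.2 hm)
        subst this
        exact Or.inr hZ
    · rintro (h | h)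
      · exact ⟨_, ∅, (Set.union_empty _).symm, h, (h₂ M).2⟩
      · exact ⟨∅, _, (Set.empty_union _).symm, (h₁ M).2, h⟩

end TeamLogic

theorem mainTheorem6 (L : FirstOrder.Language.{u, v}) (k : ℕ)
    (φ : TeamLogic.TeamSentence L {TeamLogic.inclusion k}) :
    ∃ ψ : TeamLogic.TeamSentence L {TeamLogic.exclusion k},
      ∀ (M : Type w) [L.Structure M] [Nontrivial M],
        TeamLogic.TeamSentence.IsTrueIn φ M ↔ TeamLogic.TeamSentence.IsTrueIn ψ M := by
  obtain ⟨ι, _, χ, hχ⟩ := TeamLogic.exists_predDefinable_iff_isTrueIn.{u, v, w} φ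
  obtain ⟨ψ, hψ⟩ := TeamLogic.exists_sentence_iff_exists_predRealize.{u, v, w} χ
  exact ⟨ψ, fun M _ _ => (hχ M).trans (hψ M).symm⟩
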